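/- Let $G$ be a finite simple plane graph whose outer face is bounded by a cycle of length $n$ (a simple closed boundary) and each of whose internal (non-outer) faces is a triangle or a quadrangle, i.e. is bounded by a closed walk of length $3$ or $4$. Here a plane graph is taken up to orientation-preserving homeomorphism and is described by its rotation system: a connected simple graph together with a cyclic order of the edges around each vertex such that the resulting closed oriented surface has genus $0$, and with one of the faces designated as the outer one. Call a vertex internal if it does not lie on the boundary cycle, and for an internal vertex $v$ let $t(v)$ and $q(v)$ be the numbers of triangular and quadrangular faces containing $v$. Suppose that $G$ has at least one internal vertex and that $2t(v)+3q(v)\ge 12$ for every internal vertex $v$. Then $n\ge 6$. -/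

import Mathlib

/-- A rotation system on a simple graph `G`: a permutation `next` of the darts (oriented edges) of
`G` that keeps the starting vertex and cyclically permutes all darts leaving a given vertex.
It records the anticlockwise order of the edges around each vertex of a drawing of `G` on an
oriented surface. -/
structure RotationSystem {V : Type*} (G : SimpleGraph V) where
  /-- the next dart, in anticlockwise order, around the starting vertex -/
  next : Equiv.Perm G.Dart
  next_fst : ∀ d : G.Dart, (next d).fst = d.fst
  cyclic : ∀ d e : G.Dart, d.fst = e.fst → next.SameCycle d e

namespace RotationSystem

variable {V : Type*} {G : SimpleGraph V}

/-- The dart following `d` along the boundary of the face beside `d`: traverse `d`, then leave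
along the edge next to it in the rotation at its endpoint. -/
def faceNext (R : RotationSystem G) : Equiv.Perm G.Dart :=
  (SimpleGraph.Dart.symm_involutive (G := G)).toPerm.trans R.next

/-- The faces: the cycles of `faceNext`, each of which is the closed boundary walk of a face. -/
def Face (R : RotationSystem G) : Type _ :=
  Quotient (Equiv.Perm.SameCycle.setoid R.faceNext)

/-- The face beside a dart. -/
def face (R : RotationSystem G) (d : G.Dart) : R.Face :=
  Quotient.mk (Equiv.Perm.SameCycle.setoid R.faceNext) d

/-- The length of the boundary walk of a face. -/
noncomputable def faceLength (R : RotationSystem G) (f : R.Face) : ℕ :=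
  {d : G.Dart | R.face d = f}.ncard

/-- The vertex `v` lies on (the boundary of) the face `f`. -/
def OnFace (R : RotationSystem G) (v : V) (f : R.Face) : Prop :=
  ∃ d : G.Dart, R.face d = f ∧ d.fst = v

/-- The Euler characteristic `|V| - |E| + |F|` of the closed surface that is obtained from `G` by
gluing a disc along each facial walk. -/
noncomputable def eulerChar (R : RotationSystem G) : ℤ :=
  (Nat.card V : ℤ) - (G.edgeSet.ncard : ℤ) + (Nat.card R.Face : ℤ)

/-- The rotation system describes a plane drawing: `G` is connected and the closed oriented surface
on which it is drawn has genus zero, that is, Euler characteristic `2`, so is the sphere. -/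
def IsPlane (R : RotationSystem G) : Prop :=
  G.Connected ∧ R.eulerChar = 2

/-- The boundary of the face `f` is a simple closed curve, i.e. a cycle of `G`: the boundary walk
has length at least three and visits no vertex twice. -/
def HasSimpleBoundary (R : RotationSystem G) (f : R.Face) : Prop :=
  3 ≤ R.faceLength f ∧ Set.InjOn (fun d : G.Dart => d.fst) {d : G.Dart | R.face d = f}

/-- The number of triangular faces containing `v`. -/
noncomputable def triangleCount (R : RotationSystem G) (v : V) : ℕ :=
  {f : R.Face | R.faceLength f = 3 ∧ R.OnFace v f}.ncard

/-- The number of quadrangular faces containing `v`. -/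
noncomputable def quadrangleCount (R : RotationSystem G) (v : V) : ℕ :=
  {f : R.Face | R.faceLength f = 4 ∧ R.OnFace v f}.ncard

end RotationSystem

/-! Measure angles in units of π/6, giving a triangle corner 2 and a quadrangle corner 3. The
hypothesis says that every internal vertex has total angle at least 2π = 12, so Euler's formula
(`sum_weight`) becomes a Gauss-Bonnet inequality: the boundary angles sum to at most 6n - 12.
Suppose n ≤ 5. For n ≥ 4, if some boundary angle is a single triangle corner, cutting off that
triangle shortens the curve by one and preserves the inequality (`cut_ear`). If there is no such
corner, or if n = 3, arithmetic forces every sector to be one corner (n = 3, 4) or gives a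
contradiction (n = 5). No interior of the curve is ever constructed. `IsDisc` keeps the original
boundary vertex set `O` through all cuts and records only that an edge leaving `O` starts strictly
inside a sector. If all sectors are single corners, no edge leaves `O`; connectedness then makes `O`
everything (`IsDisc.eq_univ`), against the existence of an internal vertex. -/

/-! ### Cycles of permutations -/

open Function in
theorem Equiv.Perm.SameCycle.exists_pow_eq_lt_minimalPeriod {α : Type*} [Finite α]
    {σ : Equiv.Perm α} {x y : α} (h : σ.SameCycle x y) :
    ∃ j < minimalPeriod σ x, (σ ^ j) x = y := by
  obtain ⟨i, rfl⟩ := h.exists_nat_pow_eq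
  have hp : 0 < minimalPeriod σ x := minimalPeriod_pos_of_mem_periodicPts
    (σ.injective.mem_periodicPts x)
  refine ⟨i % minimalPeriod σ x, Nat.mod_lt _ hp, ?_⟩
  rw [← Equiv.Perm.iterate_eq_pow, ← Equiv.Perm.iterate_eq_pow, iterate_mod_minimalPeriod_eq]

open Function in
theorem Equiv.Perm.ncard_sameCycle {α : Type*} [Finite α] (σ : Equiv.Perm α) (x : α) :
    {y | σ.SameCycle x y}.ncard = minimalPeriod σ x := by
  have h : {y | σ.SameCycle x y} = (fun j => σ^[j] x) '' Set.Iio (minimalPeriod σ x) := by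
    ext y
    constructor
    · intro h
      obtain ⟨j, hj, rfl⟩ := h.exists_pow_eq_lt_minimalPeriod
      exact ⟨j, hj, by simp [Equiv.Perm.iterate_eq_pow]⟩
    · rintro ⟨j, -, rfl⟩
      exact ⟨j, by simp [Equiv.Perm.iterate_eq_pow]⟩
  rw [h, Set.InjOn.ncard_image iterate_injOn_Iio_minimalPeriod, ← Finset.coe_Iio,
    Set.ncard_coe_finset, Nat.card_Iio]

/-! ### Faces, corners and angles -/

namespace RotationSystem

variable {V : Type*} {G : SimpleGraph V} (R : RotationSystem G)

theorem faceNext_apply (d : G.Dart) : R.faceNext d = R.next d.symm := rfl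

theorem faceNext_fst (d : G.Dart) : (R.faceNext d).fst = d.snd := R.next_fst d.symm

theorem next_pow_fst (d : G.Dart) (j : ℕ) : ((R.next ^ j) d).fst = d.fst := by
  induction j with
  | zero => rfl
  | succ j ih => rw [pow_succ', Equiv.Perm.mul_apply, R.next_fst, ih]

theorem face_eq_iff {d e : G.Dart} : R.face d = R.face e ↔ R.faceNext.SameCycle d e :=
  Quotient.eq (r := Equiv.Perm.SameCycle.setoid R.faceNext)

theorem face_faceNext (d : G.Dart) : R.face (R.faceNext d) = R.face d :=
  R.face_eq_iff.2 (Equiv.Perm.sameCycle_apply_left.2 (Equiv.Perm.SameCycle.refl _ _))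

theorem faceLength_face [Finite V] (d : G.Dart) :
    R.faceLength (R.face d) = Function.minimalPeriod R.faceNext d := by
  classical
  have := Fintype.ofFinite V
  rw [← Equiv.Perm.ncard_sameCycle, faceLength]
  congr 1
  ext e
  exact eq_comm.trans R.face_eq_iff

theorem faceNext_pow_faceLength [Finite V] (d : G.Dart) :
    (R.faceNext ^ R.faceLength (R.face d)) d = d := by
  rw [R.faceLength_face, ← Equiv.Perm.iterate_eq_pow, Function.iterate_minimalPeriod]

open Classical in
/-- The angle of the corner at the start of a dart, in units of `π / 6`, when triangles and
quadrangles are regular; the corners of the outer face count zero. -/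
noncomputable def weight (outer : R.Face) (d : G.Dart) : ℕ :=
  if R.face d = outer then 0 else R.faceLength (R.face d) - 1

theorem weight_faceNext (outer : R.Face) (d : G.Dart) :
    R.weight outer (R.faceNext d) = R.weight outer d := by
  unfold weight
  rw [R.face_faceNext]

theorem weight_next (outer : R.Face) (d : G.Dart) :
    R.weight outer (R.next d) = R.weight outer d.symm := by
  rw [← R.weight_faceNext outer d.symm, faceNext_apply, SimpleGraph.Dart.symm_symm]

theorem faceNext_pow_weight [Finite V] {outer : R.Face} {d : G.Dart}
    (h : R.weight outer d ≠ 0) : (R.faceNext ^ (R.weight outer d + 1)) d = d := by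
  unfold weight at h ⊢
  split_ifs at h ⊢ with hd
  · simp at h
  · rw [Nat.sub_add_cancel (by omega)]
    exact R.faceNext_pow_faceLength d

/-- The total angle of the `m` corners that follow the dart `c` around its starting vertex. -/
noncomputable def sectorAngle (outer : R.Face) (c : G.Dart) (m : ℕ) : ℕ :=
  ∑ j ∈ Finset.range m, R.weight outer ((R.next ^ (j + 1)) c)

theorem sectorAngle_succ (outer : R.Face) (c : G.Dart) (m : ℕ) :
    R.sectorAngle outer c (m + 1) =
      R.sectorAngle outer c m + R.weight outer ((R.next ^ (m + 1)) c) :=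
  Finset.sum_range_succ _ _

theorem sectorAngle_succ' (outer : R.Face) (c : G.Dart) (m : ℕ) :
    R.sectorAngle outer c (m + 1) =
      R.sectorAngle outer (R.next c) m + R.weight outer (R.next c) := by
  rw [sectorAngle, Finset.sum_range_succ']
  rfl

/-- The closed curve with darts `c 0, c 1, …` visits no vertex twice; at each of its vertices
the sector of `m i` corners to its left lies in inner faces; the angles satisfy the Gauss-Bonnet
inequality; and every dart that leaves the vertex set `O` points strictly into one of the
sectors. -/
structure IsDisc (outer : R.Face) (O : Set V) {k : ℕ} [NeZero k] (c : Fin k → G.Dart)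
    (m : Fin k → ℕ) : Prop where
  link : ∀ i, (R.next ^ m (i + 1)) (c (i + 1)) = (c i).symm
  pos : ∀ i, 0 < m i
  inj : Function.Injective fun i => (c i).fst
  mem : ∀ i, (c i).fst ∈ O
  two_le : ∀ i, ∀ j < m i, 2 ≤ R.weight outer ((R.next ^ (j + 1)) (c i))
  cover : ∀ d : G.Dart, d.fst ∈ O →
    d.snd ∈ O ∨ ∃ i j, 0 < j ∧ j < m i ∧ d = (R.next ^ j) (c i)
  angle : ∑ i, R.sectorAngle outer (c i) (m i) + 12 ≤ 6 * k

/-! ### Closed curves satisfying Gauss-Bonnet, and cutting off ears -/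

namespace IsDisc

variable {R} {outer : R.Face} {O : Set V} {k : ℕ} [NeZero k] {c : Fin k → G.Dart}
  {m : Fin k → ℕ}

theorem snd_eq (h : R.IsDisc outer O c m) (i : Fin k) : (c i).snd = (c (i + 1)).fst := by
  have := congrArg (fun d : G.Dart => d.fst) (h.link i)
  simpa [R.next_pow_fst] using this.symm

theorem rotate (h : R.IsDisc outer O c m) (r : Fin k) :
    R.IsDisc outer O (fun i => c (i + r)) (fun i => m (i + r)) where
  link i := by simpa only [add_right_comm] using h.link (i + r)
  pos i := h.pos _
  inj i j hij := add_right_cancel (h.inj hij)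
  mem i := h.mem _
  two_le i := h.two_le _
  cover d hd := by
    obtain hd | ⟨i, j, hj⟩ := h.cover d hd
    · exact Or.inl hd
    · exact Or.inr ⟨i - r, j, by simpa using hj⟩
  angle := by
    have := Equiv.sum_comp (Equiv.addRight r) fun i => R.sectorAngle outer (c i) (m i)
    simp only [Equiv.coe_addRight] at this
    rw [this]
    exact h.angle

theorem two_mul_le (h : R.IsDisc outer O c m) (i : Fin k) :
    2 * m i ≤ R.sectorAngle outer (c i) (m i) := by
  have := Finset.card_nsmul_le_sum (Finset.range (m i))
    (fun j => R.weight outer ((R.next ^ (j + 1)) (c i))) 2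
    fun j hj => h.two_le i j (Finset.mem_range.1 hj)
  simpa [mul_comm, sectorAngle] using this

theorem eq_univ (h : R.IsDisc outer O c m) (hG : G.Connected) (hm : ∀ i, m i = 1) :
    O = Set.univ := by
  have step : ∀ u v, G.Adj u v → u ∈ O → v ∈ O := by
    intro u v huv hu
    obtain hv | ⟨i, j, h0, h1, -⟩ := h.cover ⟨(u, v), huv⟩ hu
    · exact hv
    · have := hm i
      omega
  have walk : ∀ u v, G.Walk u v → u ∈ O → v ∈ O := by
    intro u v p
    induction p with
    | nil => exact id
    | cons huv _ ih => exact fun hu => ih (step _ _ huv hu)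
  refine Set.eq_univ_of_forall fun v => ?_
  obtain ⟨p⟩ := hG.preconnected (c 0).fst v
  exact walk _ _ p (h.mem 0)

theorem weight_last (h : R.IsDisc outer O c m) (i : Fin k) :
    R.weight outer ((R.next ^ m (i + 1)) (c (i + 1))) = R.weight outer (R.next (c i)) := by
  rw [h.link, R.weight_next]

/-- A sector of more than one corner contains its first and its last corner. -/
theorem angle_cases (h : R.IsDisc outer O c m) (i : Fin k) :
    (m (i + 1) = 1 ∧ R.weight outer (R.next (c (i + 1))) = R.weight outer (R.next (c i)) ∧
      R.sectorAngle outer (c (i + 1)) (m (i + 1)) = R.weight outer (R.next (c i))) ∨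
    (2 ≤ m (i + 1) ∧
      R.weight outer (R.next (c (i + 1))) + R.weight outer (R.next (c i)) ≤
        R.sectorAngle outer (c (i + 1)) (m (i + 1))) := by
  have hl := h.weight_last i
  obtain hm | hm : m (i + 1) = 1 ∨ 2 ≤ m (i + 1) := by have := h.pos (i + 1); omega
  · rw [hm, pow_one] at hl
    refine Or.inl ⟨hm, hl, ?_⟩
    rw [hm, sectorAngle_succ']
    simp [sectorAngle, hl]
  · refine Or.inr ⟨hm, ?_⟩
    obtain ⟨l, hl'⟩ : ∃ l, m (i + 1) = l + 1 + 1 := ⟨m (i + 1) - 2, by omega⟩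
    rw [hl'] at hl ⊢
    rw [sectorAngle_succ, hl, sectorAngle_succ']
    omega

theorem two_le_first (h : R.IsDisc outer O c m) (i : Fin k) :
    2 ≤ R.weight outer (R.next (c i)) := by
  simpa using h.two_le i 0 (h.pos i)

/-- The third side of a triangle with a corner of degree two on the curve. -/
theorem ear [Finite V] (h : R.IsDisc outer O c m) (i : Fin k) (hm : m (i + 1) = 1)
    (hw : R.weight outer (R.next (c (i + 1))) = 2) :
    R.next (R.next (c i)).symm = (c (i + 1)).symm := by
  have hl := h.link i
  rw [hm, pow_one] at hl
  -- The triangle's boundary walk is `(c (i + 1)).symm`, `(c i).symm`, `R.next (c i)`, and then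
  -- closes.
  have h3 := R.faceNext_pow_weight (outer := outer) (d := (c (i + 1)).symm)
    (by rw [← R.weight_next, hw]; decide)
  rw [← R.weight_next, hw] at h3
  simpa [pow_succ, faceNext_apply, hl] using h3

/-- If the corner before the ear were also single, the triangle's third side would be the preceding
edge of the curve, which would then close after three steps. The same argument applies to the corner
after the ear. -/
theorem two_le_before [Finite V] (h : R.IsDisc outer O c m) (i : Fin k)
    (hne : i ≠ i + 1 + 1 + 1) (hm : m (i + 1 + 1) = 1)
    (hw : R.weight outer (R.next (c (i + 1 + 1))) = 2) : 2 ≤ m (i + 1) := by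
  by_contra hlt
  have hl := h.link i
  rw [show m (i + 1) = 1 by have := h.pos (i + 1); omega, pow_one] at hl
  have he := congrArg (fun d : G.Dart => d.fst) (h.ear (i + 1) hm hw)
  simp only [hl, SimpleGraph.Dart.symm_symm, R.next_fst] at he
  refine hne (h.inj (he.trans ?_))
  exact h.snd_eq (i + 1 + 1)

theorem two_le_after [Finite V] (h : R.IsDisc outer O c m) (i : Fin k)
    (hne : i ≠ i + 1 + 1 + 1) (hm : m (i + 1) = 1)
    (hw : R.weight outer (R.next (c (i + 1))) = 2) : 2 ≤ m (i + 1 + 1) := by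
  by_contra hlt
  have hl := h.link (i + 1)
  rw [show m (i + 1 + 1) = 1 by have := h.pos (i + 1 + 1); omega, pow_one,
    ← h.ear i hm hw] at hl
  have he := congrArg (fun d : G.Dart => d.snd) (R.next.injective hl)
  refine hne (h.inj (Eq.symm ?_))
  change (c (i + 1 + 1 + 1)).fst = (c i).fst
  rw [← h.snd_eq, he]
  exact R.next_fst (c i)

/-- Cutting off a triangle with a corner of degree two on the curve. -/
theorem cut_ear [Finite V] {k : ℕ} {c : Fin (k + 4) → G.Dart} {m : Fin (k + 4) → ℕ}
    (h : R.IsDisc outer O c m) (hm : m 0 = 1) (hw : R.weight outer (R.next (c 0)) = 2) :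
    R.IsDisc outer O
      (fun i : Fin (k + 3) => if i = Fin.last _ then R.next (c i.succ) else c i.succ)
      (fun i => m i.succ - (if i = 0 then 1 else 0) - (if i = Fin.last _ then 1 else 0)) := by
  have hlast : Fin.last (k + 3) + 1 = 0 := Fin.last_add_one _
  have hear := h.ear (Fin.last (k + 3)) (by rwa [hlast]) (by rwa [hlast])
  have hlink := h.link (Fin.last (k + 3))
  have hlink0 := h.link 0
  have hwl := h.weight_last (Fin.last (k + 3))
  have hwl0 := h.weight_last 0
  have hsnd0 := h.snd_eq 0
  rw [hlast] at hear hlink hwl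
  rw [zero_add] at hlink0 hwl0 hsnd0
  have hne : (0 : Fin (k + 3)) ≠ Fin.last _ := (Fin.last_pos).ne
  have hafter : 2 ≤ m 1 := by
    have := h.two_le_after (Fin.last (k + 3)) (by
      rw [hlast, zero_add]
      intro h
      have := congrArg Fin.val h
      simp only [Fin.val_add, Fin.val_last, Fin.val_one] at this
      rw [Nat.mod_eq_of_lt (by omega)] at this
      omega) (by rwa [hlast]) (by rwa [hlast])
    rwa [hlast, zero_add] at this
  have hprev : Fin.last (k + 3) = (Fin.last (k + 2)).castSucc + 1 := by
    simp
  have hbefore : 2 ≤ m (Fin.last _) := by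
    have := h.two_le_before (Fin.last (k + 2)).castSucc (by
      rw [← hprev, hlast, zero_add]
      intro h
      have := congrArg Fin.val h
      simp at this)
      (by rwa [← hprev, hlast]) (by rwa [← hprev, hlast])
    rwa [← hprev] at this
  -- The new edge, the third side of the ear, comes right after the old edge at the last vertex and,
  -- reversed, right before `(c 0).symm` at vertex 1. So the former loses its first corner and the
  -- latter its last.
  have hfirst : (R.next ^ (m 1 - 1)) (c 1) = (R.next (c (Fin.last (k + 3)))).symm := by
    apply R.next.injective
    rw [hear, ← hlink0, ← Equiv.Perm.mul_apply, ← pow_succ', Nat.sub_add_cancel (by omega)]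
  have hfst : ∀ i : Fin (k + 3),
      (if i = Fin.last _ then R.next (c i.succ) else c i.succ).fst = (c i.succ).fst := by
    intro i
    split_ifs
    · exact R.next_fst _
    · rfl
  have hsucc : ∀ (d : G.Dart) (j : ℕ), (R.next ^ j) (R.next d) = (R.next ^ (j + 1)) d :=
    fun d j => by rw [pow_succ, Equiv.Perm.mul_apply]
  refine ⟨?_, ?_, ?_, ?_, ?_, ?_, ?_⟩
  · intro i
    obtain rfl | hi := eq_or_ne i (Fin.last _)
    · simpa [hne] using hfirst
    · have hi' : (i + 1).succ = i.succ + 1 := by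
        ext
        rw [Fin.val_succ, Fin.val_add_one_of_lt (Fin.lt_last_iff_ne_last.2 hi),
          Fin.val_add_one_of_lt, Fin.val_succ]
        rw [Fin.lt_def, Fin.val_succ, Fin.val_last]
        have := Fin.val_lt_last hi
        omega
      have hi0 : i + 1 ≠ 0 := by
        intro h0
        rw [h0] at hi'
        have := h.link i.succ
        exact hi (add_right_cancel (h0.trans (Fin.last_add_one _).symm))
      have hl := h.link i.succ
      rw [← hi'] at hl
      simp only [hi, hi0, if_false, Nat.sub_zero]
      split_ifs with hj
      · rw [hsucc, Nat.sub_add_cancel (h.pos _), hl]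
      · exact hl
  · intro i
    obtain rfl | hi := eq_or_ne i 0
    · simp [hne]; omega
    · obtain rfl | hj := eq_or_ne i (Fin.last _)
      · have : 2 ≤ m (Fin.last (k + 2)).succ := hbefore
        simp only [hne.symm, if_true, if_false]
        omega
      · simpa [hi, hj] using h.pos _
  · intro i j hij
    simp only [hfst] at hij
    exact Fin.succ_injective _ (h.inj hij)
  · intro i
    rw [hfst]
    exact h.mem _
  · intro i j hj
    obtain hi | hi := eq_or_ne i (Fin.last _)
    · simp only [hi, if_true, hne.symm, if_false] at hj ⊢
      rw [hsucc]
      exact h.two_le _ _ (by omega)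
    · simp only [hi, if_false] at hj ⊢
      exact h.two_le _ _ (by omega)
  · intro d hd
    obtain hd | ⟨i, j, hj0, hj, rfl⟩ := h.cover d hd
    · exact Or.inl hd
    obtain rfl | ⟨i, rfl⟩ := i.eq_zero_or_eq_succ
    · omega
    obtain rfl | hi := eq_or_ne i (Fin.last _)
    -- The only darts that stop being strictly inside a sector are the two directions of the new
    -- edge, whose ends both lie in `O`.
    · obtain rfl | hj1 : j = 1 ∨ 2 ≤ j := by omega
      · refine Or.inl ?_
        have := congrArg (fun d : G.Dart => d.fst) hear
        simp only [R.next_fst] at this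
        change (R.next (c (Fin.last (k + 3)))).snd ∈ O
        have h1 := h.mem 1
        rw [← hsnd0] at h1
        exact (show (R.next (c (Fin.last (k + 3)))).snd = (c 0).snd from this) ▸ h1
      · refine Or.inr ⟨Fin.last _, j - 1, by omega, ?_, ?_⟩
        · simp only [hne.symm, if_true, if_false]
          omega
        · rw [if_pos rfl, hsucc, Nat.sub_add_cancel (by omega)]
    · obtain rfl | h0 := eq_or_ne i 0
      · obtain rfl | hj1 : j = m 1 - 1 ∨ j < m 1 - 1 := by
          simp only [Fin.succ_zero_eq_one] at hj
          omega
        · refine Or.inl ?_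
          rw [Fin.succ_zero_eq_one, hfirst]
          change (R.next (c (Fin.last (k + 3)))).fst ∈ O
          rw [R.next_fst]
          exact h.mem _
        · exact Or.inr ⟨0, j, hj0, by simpa [hne] using hj1, by simp [hne]⟩
      · exact Or.inr ⟨i, j, hj0, by simpa [hi, h0] using hj, by simp [hi]⟩
  -- Each neighbour of the ear loses angle 2 and the ear's own angle is at least 2: the total drops
  -- by at least 6, matching the loss of one vertex.
  · have key : ∀ i : Fin (k + 3), R.sectorAngle outer
        (if i = Fin.last _ then R.next (c i.succ) else c i.succ)
        (m i.succ - (if i = 0 then 1 else 0) - (if i = Fin.last _ then 1 else 0)) +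
        ((if i = 0 then 2 else 0) + (if i = Fin.last _ then 2 else 0)) =
        R.sectorAngle outer (c i.succ) (m i.succ) := by
      intro i
      obtain rfl | hi := eq_or_ne i (Fin.last _)
      · have := R.sectorAngle_succ' outer (c (Fin.last (k + 3))) (m (Fin.last (k + 3)) - 1)
        rw [Nat.sub_add_cancel (by omega), ← hwl, hm, pow_one, hw] at this
        simpa [hne.symm] using this.symm
      · obtain rfl | h0 := eq_or_ne i 0
        · have := R.sectorAngle_succ outer (c 1) (m 1 - 1)
          rw [Nat.sub_add_cancel (by omega), hwl0, hw] at this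
          simpa [hne] using this.symm
        · simp [hi, h0]
    have ha := h.angle
    rw [Fin.sum_univ_succ, ← Finset.sum_congr rfl fun i _ => key i, Finset.sum_add_distrib,
      Finset.sum_add_distrib] at ha
    have h0 := h.two_mul_le 0
    simp only [Finset.sum_ite_eq', Finset.mem_univ, if_true] at ha
    omega

/-! ### Curves of length three, four and five -/

theorem eq_univ_of_three [Finite V] {c : Fin 3 → G.Dart} {m : Fin 3 → ℕ}
    (h : R.IsDisc outer O c m) (hG : G.Connected) : O = Set.univ := by
  refine h.eq_univ hG fun i => ?_
  have ha := h.angle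
  have h0 := h.two_mul_le
  have h1 := h.pos
  simp only [Fin.sum_univ_three] at ha
  have := h0 0; have := h0 1; have := h0 2
  have := h1 0; have := h1 1; have := h1 2
  fin_cases i <;> simp only [Fin.zero_eta, Fin.mk_one, Fin.reduceFinMk] <;> omega

theorem exists_isDisc_of_angle_le_two [Finite V] {k : ℕ} {c : Fin (k + 4) → G.Dart} {m : Fin (k + 4) → ℕ}
    (h : R.IsDisc outer O c m) {i : Fin (k + 4)} (hi : R.sectorAngle outer (c i) (m i) ≤ 2) :
    ∃ (c' : Fin (k + 3) → G.Dart) (m' : Fin (k + 3) → ℕ), R.IsDisc outer O c' m' := by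
  have h2 := h.two_mul_le i
  have h0 := h.pos i
  have hm : m i = 1 := by omega
  have h3 := h.two_le_first i
  have h4 : R.sectorAngle outer (c i) (m i) = R.weight outer (R.next (c i)) := by
    rw [hm, sectorAngle_succ']
    simp [sectorAngle]
  exact ⟨_, _, (h.rotate i).cut_ear (by simpa using hm)
    (by simp only [zero_add]; omega)⟩

/-- Without an ear, four angles of at least 3 sum to at most 12, so all equal 3; two corners would
need 4. -/
theorem eq_univ_of_four [Finite V] {c : Fin 4 → G.Dart} {m : Fin 4 → ℕ}
    (h : R.IsDisc outer O c m) (hG : G.Connected) : O = Set.univ := by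
  by_cases hc : ∃ i, R.sectorAngle outer (c i) (m i) ≤ 2
  · obtain ⟨i, hi⟩ := hc
    obtain ⟨c', m', h'⟩ := h.exists_isDisc_of_angle_le_two hi
    exact h'.eq_univ_of_three hG
  · push Not at hc
    refine h.eq_univ hG fun i => ?_
    have ha := h.angle
    have h0 := h.two_mul_le
    have h1 := h.pos
    simp only [Fin.sum_univ_four] at ha
    have := h0 0; have := h0 1; have := h0 2; have := h0 3
    have := h1 0; have := h1 1; have := h1 2; have := h1 3
    have := hc 0; have := hc 1; have := hc 2; have := hc 3
    fin_cases i <;> simp only [Fin.zero_eta, Fin.mk_one, Fin.reduceFinMk] <;> omega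

/-- Four consecutive corners of degree two on a quadrangle close the curve after four steps. -/
theorem not_four_single [Finite V] {c : Fin 5 → G.Dart} {m : Fin 5 → ℕ}
    (h : R.IsDisc outer O c m) :
    ¬ (m 1 = 1 ∧ m 2 = 1 ∧ m 3 = 1 ∧ m 4 = 1 ∧ R.weight outer (R.next (c 4)) = 3) := by
  rintro ⟨h1, h2, h3, h4, hw⟩
  have l1 := h.link 0
  have l2 := h.link 1
  have l3 := h.link 2
  have l4 := h.link 3
  simp only [zero_add, Fin.reduceAdd, h1, h2, h3, h4, pow_one] at l1 l2 l3 l4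
  have hf := R.faceNext_pow_weight (outer := outer) (d := (c 4).symm)
    (by rw [← R.weight_next, hw]; decide)
  rw [← R.weight_next, hw] at hf
  simp only [pow_succ, pow_zero, one_mul, Equiv.Perm.mul_apply, faceNext_apply,
    SimpleGraph.Dart.symm_symm, l1, l2, l3, l4] at hf
  have := h.inj (congrArg (fun d : G.Dart => d.snd) hf : (c 0).fst = (c 4).fst)
  exact absurd this (by decide)

theorem eq_univ_of_five [Finite V] {c : Fin 5 → G.Dart} {m : Fin 5 → ℕ}
    (h : R.IsDisc outer O c m) (hG : G.Connected)
    (hle : ∀ d, R.weight outer d ≤ 3) : O = Set.univ := by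
  by_cases hc : ∃ i, R.sectorAngle outer (c i) (m i) ≤ 2
  · obtain ⟨i, hi⟩ := hc
    obtain ⟨c', m', h'⟩ := h.exists_isDisc_of_angle_le_two hi
    exact h'.eq_univ_of_four hG
  · push Not at hc
    -- Without an ear, single corners are quadrangle corners, and four in a row are excluded, so at
    -- least two sectors have several corners. Such a sector has angle at least the sum of its two
    -- extreme corners, and an extreme corner next to a single-corner vertex measures 3. In every
    -- arrangement the total exceeds the allowed 18.
    exfalso
    have n0 := h.not_four_single
    have n1 := (h.rotate 1).not_four_single
    have n2 := (h.rotate 2).not_four_single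
    have n3 := (h.rotate 3).not_four_single
    have n4 := (h.rotate 4).not_four_single
    have ha := h.angle
    have a0 := h.angle_cases 4
    have a1 := h.angle_cases 0
    have a2 := h.angle_cases 1
    have a3 := h.angle_cases 2
    have a4 := h.angle_cases 3
    simp only [Fin.sum_univ_five] at ha
    simp only [Fin.reduceAdd, zero_add] at n0 n1 n2 n3 n4 a0 a1 a2 a3 a4
    have c0 := hc 0; have c1 := hc 1; have c2 := hc 2; have c3 := hc 3; have c4 := hc 4
    have f0 := h.two_le_first 0; have f1 := h.two_le_first 1
    have f2 := h.two_le_first 2; have f3 := h.two_le_first 3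
    have f4 := h.two_le_first 4
    have g0 := hle (R.next (c 0)); have g1 := hle (R.next (c 1))
    have g2 := hle (R.next (c 2)); have g3 := hle (R.next (c 3))
    have g4 := hle (R.next (c 4))
    omega

end IsDisc
end RotationSystem

/-! ### Gauss-Bonnet from Euler's formula -/

namespace RotationSystem

variable {V : Type*} {G : SimpleGraph V} (R : RotationSystem G)

instance [Finite V] : Finite R.Face := by
  classical
  have := Fintype.ofFinite V
  exact Quotient.finite (Equiv.Perm.SameCycle.setoid R.faceNext)

open Classical in
theorem card_filter_face_eq [Fintype V] (f : R.Face) :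
    (Finset.univ.filter fun d : G.Dart => R.face d = f).card = R.faceLength f := by
  rw [faceLength, ← Set.ncard_coe_finset]
  simp

theorem weight_eq_two {outer : R.Face} {d : G.Dart} (hd : R.face d ≠ outer)
    (hl : R.faceLength (R.face d) = 3) : R.weight outer d = 2 := by
  simp [weight, hd, hl]

theorem weight_eq_three {outer : R.Face} {d : G.Dart} (hd : R.face d ≠ outer)
    (hl : R.faceLength (R.face d) = 4) : R.weight outer d = 3 := by
  simp [weight, hd, hl]

theorem weight_eq_zero {outer : R.Face} {d : G.Dart} (hd : R.face d = outer) :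
    R.weight outer d = 0 := by
  simp [weight, hd]

open Classical in
/-- Euler's formula as a count of angles. -/
theorem sum_weight [Fintype V] (hplane : R.IsPlane) (outer : R.Face)
    (hfaces : ∀ f : R.Face, f ≠ outer → R.faceLength f = 3 ∨ R.faceLength f = 4) :
    ∑ d : G.Dart, R.weight outer d + 6 * R.faceLength outer + 12 = 12 * Fintype.card V := by
  have := Fintype.ofFinite R.Face
  -- For inner faces this is l(l - 1) + 12 = 6l, valid exactly for l = 3 and l = 4.
  have hface : ∀ f : R.Face, ∑ d : G.Dart with R.face d = f, R.weight outer d +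
      (12 + if f = outer then 6 * R.faceLength outer else 0) =
      6 * (Finset.univ.filter fun d : G.Dart => R.face d = f).card +
      if f = outer then 12 else 0 := by
    intro f
    obtain rfl | hf := eq_or_ne f outer
    · rw [Finset.sum_eq_zero fun d hd => R.weight_eq_zero (Finset.mem_filter.1 hd).2,
        R.card_filter_face_eq]
      simp [add_comm]
    · rw [Finset.sum_const_nat (m := R.faceLength f - 1), R.card_filter_face_eq]
      · obtain hl | hl := hfaces f hf <;> simp [hl, hf]
      · intro d hd
        obtain rfl := (Finset.mem_filter.1 hd).2
        simp [weight, hf]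
  have hsum := Finset.sum_congr rfl fun f (_ : f ∈ Finset.univ) => hface f
  simp only [Finset.sum_add_distrib, ← Finset.mul_sum, Finset.sum_ite_eq', Finset.mem_univ,
    if_true, Finset.sum_const, Finset.card_univ, smul_eq_mul] at hsum
  rw [Finset.sum_fiberwise Finset.univ R.face (R.weight outer),
    ← Finset.card_eq_sum_card_fiberwise (f := R.face) fun _ _ => Finset.mem_univ _,
    Finset.card_univ, G.dart_card_eq_twice_card_edges] at hsum
  have heuler := hplane.2
  rw [eulerChar, Nat.card_eq_fintype_card, Nat.card_eq_fintype_card,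
    ← SimpleGraph.coe_edgeFinset, Set.ncard_coe_finset] at heuler
  omega

open Classical in
-- A face may have several corners at `v`, so counting faces only bounds the number of corners from
-- below, which is the direction needed.
theorem twelve_le_sum_weight [Fintype V] {outer : R.Face}
    (hfaces : ∀ f : R.Face, f ≠ outer → R.faceLength f = 3 ∨ R.faceLength f = 4)
    {v : V} (hv : ¬ R.OnFace v outer)
    (hcurv : 12 ≤ 2 * R.triangleCount v + 3 * R.quadrangleCount v) :
    12 ≤ ∑ d : G.Dart with d.fst = v, R.weight outer d := by
  have hcount : ∀ l, {f : R.Face | R.faceLength f = l ∧ R.OnFace v f}.ncard ≤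
      (Finset.univ.filter fun d : G.Dart => d.fst = v ∧ R.faceLength (R.face d) = l).card := by
    intro l
    rw [← Set.ncard_coe_finset]
    refine (Set.ncard_le_ncard (t := R.face '' _) ?_).trans (Set.ncard_image_le (Set.toFinite _))
    rintro f ⟨hf, d, rfl, hd⟩
    exact ⟨d, by simp [hd, hf], rfl⟩
  have h3 : R.triangleCount v ≤ _ := hcount 3
  have h4 : R.quadrangleCount v ≤ _ := hcount 4
  have hsum : ∑ d : G.Dart with d.fst = v, R.weight outer d =
      ∑ d : G.Dart with d.fst = v, (2 * (if R.faceLength (R.face d) = 3 then 1 else 0) +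
        3 * (if R.faceLength (R.face d) = 4 then 1 else 0)) := by
    refine Finset.sum_congr rfl fun d hd => ?_
    have hne : R.face d ≠ outer := fun h => hv ⟨d, h, (Finset.mem_filter.1 hd).2⟩
    obtain hl | hl := hfaces _ hne
    · simp [R.weight_eq_two hne hl, hl]
    · simp [R.weight_eq_three hne hl, hl]
  rw [hsum, Finset.sum_add_distrib, ← Finset.mul_sum, ← Finset.mul_sum, ← Finset.card_filter,
    ← Finset.card_filter, Finset.filter_filter, Finset.filter_filter]
  omega

theorem injOn_next_pow [Finite V] (c : G.Dart) :
    Set.InjOn (fun j => (R.next ^ j) c) (Set.Iio (Function.minimalPeriod R.next c)) := by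
  simpa only [Equiv.Perm.iterate_eq_pow] using
    Function.iterate_injOn_Iio_minimalPeriod (f := R.next) (x := c)

open Classical in
theorem sectorAngle_le [Fintype V] (outer : R.Face) (c : G.Dart) :
    R.sectorAngle outer c (Function.minimalPeriod R.next c - 1) ≤
      ∑ d : G.Dart with d.fst = c.fst, R.weight outer d := by
  rw [sectorAngle, ← Finset.sum_image (f := R.weight outer) (g := fun j => (R.next ^ (j + 1)) c)]
  · refine Finset.sum_le_sum_of_subset fun d hd => ?_
    obtain ⟨j, -, rfl⟩ := Finset.mem_image.1 hd
    simp [R.next_pow_fst]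
  · intro i hi j hj hij
    rw [Finset.mem_coe, Finset.mem_range] at hi hj
    have := R.injOn_next_pow c (Set.mem_Iio.2 (by omega : i + 1 < _))
      (Set.mem_Iio.2 (by omega : j + 1 < _)) hij
    omega

open Classical in
theorem sum_onFace_le [Fintype V] (hplane : R.IsPlane) (outer : R.Face)
    (hfaces : ∀ f : R.Face, f ≠ outer → R.faceLength f = 3 ∨ R.faceLength f = 4)
    (hcurv : ∀ v : V, ¬ R.OnFace v outer →
      12 ≤ 2 * R.triangleCount v + 3 * R.quadrangleCount v) :
    ∑ v with R.OnFace v outer, ∑ d : G.Dart with d.fst = v, R.weight outer d +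
      6 * R.faceLength outer + 12 ≤ 12 * (Finset.univ.filter fun v => R.OnFace v outer).card := by
  have htot := R.sum_weight hplane outer hfaces
  rw [← Finset.sum_fiberwise Finset.univ (fun d : G.Dart => d.fst),
    ← Finset.sum_filter_add_sum_filter_not Finset.univ fun v => R.OnFace v outer] at htot
  have hint := Finset.card_nsmul_le_sum (Finset.univ.filter fun v => ¬ R.OnFace v outer)
    (fun v => ∑ d : G.Dart with d.fst = v, R.weight outer d) 12 fun v hv =>
      R.twelve_le_sum_weight hfaces (Finset.mem_filter.1 hv).2 (hcurv v (Finset.mem_filter.1 hv).2)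
  have hcard := Finset.card_filter_add_card_filter_not (s := Finset.univ)
    fun v => R.OnFace v outer
  rw [Finset.card_univ] at hcard
  rw [smul_eq_mul] at hint
  omega

/-- The inside of the outer face is a disc. -/
theorem exists_isDisc [Finite V] (hplane : R.IsPlane) (outer : R.Face) {k : ℕ} [NeZero k]
    (hboundary : R.HasSimpleBoundary outer) (hk : R.faceLength outer = k)
    (hfaces : ∀ f : R.Face, f ≠ outer → R.faceLength f = 3 ∨ R.faceLength f = 4)
    (hcurv : ∀ v : V, ¬ R.OnFace v outer →
      12 ≤ 2 * R.triangleCount v + 3 * R.quadrangleCount v) :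
    ∃ (c : Fin k → G.Dart) (m : Fin k → ℕ),
      R.IsDisc outer {v | R.OnFace v outer} c m := by
  classical
  have := Fintype.ofFinite V
  obtain ⟨d₀, rfl⟩ : ∃ d, R.face d = outer := Quotient.exists_rep outer
  obtain ⟨hk3, hinj⟩ := hboundary
  have hper : Function.minimalPeriod R.faceNext d₀ = k := by rw [← R.faceLength_face, hk]
  have hk3' : 3 ≤ k := hk ▸ hk3
  set c : Fin k → G.Dart := fun i => (R.faceNext ^ (i : ℕ)) d₀ with hc
  have hface : ∀ i, R.face (c i) = R.face d₀ := fun i =>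
    R.face_eq_iff.2 (Equiv.Perm.sameCycle_pow_left.2 (Equiv.Perm.SameCycle.refl _ _))
  have hsurj : ∀ d, R.face d = R.face d₀ → ∃ i, c i = d := by
    intro d hd
    obtain ⟨j, hj, rfl⟩ := (R.face_eq_iff.1 hd.symm).exists_pow_eq_lt_minimalPeriod
    exact ⟨⟨j, hper ▸ hj⟩, rfl⟩
  have hcinj : Function.Injective fun i => (c i).fst := by
    intro i j hij
    have h1 : c i = c j := hinj (hface i) (hface j) hij
    simp only [hc, ← Equiv.Perm.iterate_eq_pow] at h1
    exact Fin.ext (Function.iterate_injOn_Iio_minimalPeriod (Set.mem_Iio.2 (hper ▸ i.2))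
      (Set.mem_Iio.2 (hper ▸ j.2)) h1)
  have hsucc : ∀ i, c (i + 1) = R.faceNext (c i) := by
    intro i
    have hmod : (R.faceNext ^ ((i + 1) % k)) d₀ = (R.faceNext ^ (i + 1 : ℕ)) d₀ := by
      have := Function.iterate_mod_minimalPeriod_eq (f := R.faceNext) (x := d₀) (n := i + 1)
      rwa [hper, Equiv.Perm.iterate_eq_pow, Equiv.Perm.iterate_eq_pow] at this
    simp only [hc]
    rw [Fin.val_add, Fin.val_one', Nat.add_mod_mod, hmod, pow_succ', Equiv.Perm.mul_apply]
  have hppos : ∀ d : G.Dart, 0 < Function.minimalPeriod R.next d := fun d =>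
    Function.minimalPeriod_pos_of_mem_periodicPts (R.next.injective.mem_periodicPts d)
  have hpow : ∀ d : G.Dart, (R.next ^ Function.minimalPeriod R.next d) d = d := fun d => by
    rw [← Equiv.Perm.iterate_eq_pow, Function.iterate_minimalPeriod]
  have hmem : ∀ i, R.OnFace (c i).fst (R.face d₀) := fun i => ⟨c i, hface i, rfl⟩
  have hsnd : ∀ i, (c i).snd = (c (i + 1)).fst := fun i => by
    rw [hsucc, R.faceNext_fst]
  have hlink : ∀ i, (R.next ^ (Function.minimalPeriod R.next (c (i + 1)) - 1)) (c (i + 1)) =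
      (c i).symm := by
    intro i
    apply R.next.injective
    rw [← Equiv.Perm.mul_apply, ← pow_succ', Nat.sub_add_cancel (hppos _), hpow, hsucc]
    rfl
  have hsub : ∀ i : Fin k, i - 1 + 1 = i := fun i => sub_add_cancel i 1
  refine ⟨c, fun i => Function.minimalPeriod R.next (c i) - 1, hlink, ?_, hcinj, hmem,
    ?_, ?_, ?_⟩
  · intro i
    -- A boundary vertex of degree one would make the curve backtrack, so that the vertices before
    -- and after it coincide; this is impossible as `3 ≤ k`.
    by_contra h0
    have hl := hlink (i - 1)
    rw [hsub, show Function.minimalPeriod R.next (c i) - 1 = 0 by omega, pow_zero,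
      Equiv.Perm.one_apply] at hl
    have h1 : (c (i + 1)).fst = (c (i - 1)).fst := by rw [← hsnd, hl]; rfl
    have h2 := hcinj h1
    rw [← hsub i, add_sub_cancel_right, add_assoc, add_eq_left] at h2
    have h3 := congrArg Fin.val h2
    rw [Fin.val_add, Fin.val_one', Nat.mod_eq_of_lt (by omega : 1 < k), Nat.mod_eq_of_lt (by omega)]
      at h3
    simp at h3
  · intro i j hj
    -- As the boundary is simple, the only outer corner at this vertex is the one of `c i` itself,
    -- which the sector omits.
    have hne : R.face ((R.next ^ (j + 1)) (c i)) ≠ R.face d₀ := by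
      intro hf
      have h1 := hinj hf (hface i) (R.next_pow_fst _ _)
      have := R.injOn_next_pow (c i) (Set.mem_Iio.2 (by omega : j + 1 < _))
        (Set.mem_Iio.2 (hppos (c i))) h1
      omega
    obtain hl | hl := hfaces _ hne
    · rw [R.weight_eq_two hne hl]
    · rw [R.weight_eq_three hne hl]
      decide
  · rintro d ⟨e, he, hed⟩
    obtain ⟨i, rfl⟩ := hsurj e he
    obtain ⟨j, hj, rfl⟩ := (R.cyclic _ _ hed).exists_pow_eq_lt_minimalPeriod
    obtain rfl | hj0 := Nat.eq_zero_or_pos j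
    · exact Or.inl (by simpa [hsnd] using hmem (i + 1))
    · by_cases hj1 : j < Function.minimalPeriod R.next (c i) - 1
      · exact Or.inr ⟨i, j, hj0, hj1, rfl⟩
      · have hl := hlink (i - 1)
        rw [hsub, show Function.minimalPeriod R.next (c i) - 1 = j by omega] at hl
        rw [hl]
        exact Or.inl (hmem (i - 1))
  · have himage : (Finset.univ.filter fun v => R.OnFace v (R.face d₀)) =
        Finset.univ.image fun i => (c i).fst := by
      ext v
      simp only [Finset.mem_filter, Finset.mem_univ, true_and, Finset.mem_image]
      constructor
      · rintro ⟨e, he, rfl⟩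
        obtain ⟨i, rfl⟩ := hsurj e he
        exact ⟨i, rfl⟩
      · rintro ⟨i, rfl⟩
        exact hmem i
    have hle := R.sum_onFace_le hplane _ hfaces hcurv
    rw [himage, Finset.card_image_of_injective _ hcinj, Finset.card_univ, Fintype.card_fin,
      Finset.sum_image fun i _ j _ h => hcinj h, hk] at hle
    have := Finset.sum_le_sum fun i (_ : i ∈ Finset.univ) => R.sectorAngle_le (R.face d₀) (c i)
    omega

end RotationSystem

/-- The faces other than the distinguished face `outer` are the internal faces; the vertices not
on `outer` are the internal vertices. -/
theorem mainTheorem5 {V : Type*} [Finite V] (G : SimpleGraph V) (R : RotationSystem G)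
    (hplane : R.IsPlane) (outer : R.Face) (n : ℕ)
    (hboundary : R.HasSimpleBoundary outer) (hn : R.faceLength outer = n)
    (hfaces : ∀ f : R.Face, f ≠ outer → R.faceLength f = 3 ∨ R.faceLength f = 4)
    (hinternal : ∃ v : V, ¬ R.OnFace v outer)
    (hcurv : ∀ v : V, ¬ R.OnFace v outer →
      12 ≤ 2 * R.triangleCount v + 3 * R.quadrangleCount v) :
    6 ≤ n := by
  obtain ⟨v, hv⟩ := hinternal
  by_contra hlt
  have hle : ∀ d, R.weight outer d ≤ 3 := by
    intro d
    by_cases hd : R.face d = outer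
    · simp [R.weight_eq_zero hd]
    · obtain hl | hl := hfaces _ hd
      · simp [R.weight_eq_two hd hl]
      · simp [R.weight_eq_three hd hl]
  have h3 := hboundary.1
  have huniv : {v | R.OnFace v outer} = Set.univ := by
    obtain rfl | rfl | rfl : n = 3 ∨ n = 4 ∨ n = 5 := by omega
    · obtain ⟨c, m, h⟩ := R.exists_isDisc hplane outer hboundary hn hfaces hcurv
      exact h.eq_univ_of_three hplane.1
    · obtain ⟨c, m, h⟩ := R.exists_isDisc hplane outer hboundary hn hfaces hcurv
      exact h.eq_univ_of_four hplane.1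
    · obtain ⟨c, m, h⟩ := R.exists_isDisc hplane outer hboundary hn hfaces hcurv
      exact h.eq_univ_of_five hplane.1 hle
  exact hv (Set.eq_univ_iff_forall.1 huniv v)
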